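/- Let $d \geq 4$ be an integer. Then there exists a reflexive polytope $\mathcal{P} \subset \mathbb{R}^d$ of dimension $d$ such that, for every field $K$, $\operatorname{depth} K[\mathcal{P}] = 1$. Here a lattice polytope is a convex polytope $\mathcal{P} \subset \mathbb{R}^d$ all of whose vertices belong to $\mathbb{Z}^d$; a lattice polytope $\mathcal{P} \subset \mathbb{R}^d$ of dimension $d$ is reflexive if the origin belongs to its interior and its dual polytope $\mathcal{P}^\vee = \{x \in \mathbb{R}^d : \langle x, y\rangle \leq 1 \text{ for all } y \in \mathcal{P}\}$ is again a lattice polytope. The toric ring $K[\mathcal{P}]$ is the $K$-subalgebra of $K[t_1^{\pm 1}, \ldots, t_d^{\pm 1}, s]$ generated by the monomials $t_1^{a_1} \cdots t_d^{a_d} s$ with $(a_1, \ldots, a_d) \in \mathcal{P} \cap \mathbb{Z}^d$, and $\operatorname{depth} K[\mathcal{P}]$ is the maximal length of a $K[\mathcal{P}]$-regular sequence contained in the graded maximal ideal of $K[\mathcal{P}]$, i.e. the ideal generated by these monomials. -/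

import Mathlib

namespace ReflexivePolytope

/-- A point of `ℝ^d` all of whose coordinates are integers, i.e. a point of `ℤ^d ⊂ ℝ^d`. -/
def IsLatticePoint {d : ℕ} (x : Fin d → ℝ) : Prop :=
  ∃ a : Fin d → ℤ, x = fun i => (a i : ℝ)

/-- A convex polytope in `ℝ^d`: the convex hull of a finite set of points. -/
def IsConvexPolytope {d : ℕ} (P : Set (Fin d → ℝ)) : Prop :=
  ∃ S : Finset (Fin d → ℝ), P = convexHull ℝ (S : Set (Fin d → ℝ))

/-- A lattice polytope: a convex polytope each of whose vertices (extreme points)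
belongs to `ℤ^d`. -/
def IsLatticePolytope {d : ℕ} (P : Set (Fin d → ℝ)) : Prop :=
  IsConvexPolytope P ∧ ∀ v ∈ P.extremePoints ℝ, IsLatticePoint v

/-- The dimension of `P ⊂ ℝ^d`: the dimension of its affine span. -/
noncomputable def dimension {d : ℕ} (P : Set (Fin d → ℝ)) : ℕ :=
  Module.finrank ℝ (vectorSpan ℝ P)

/-- The dual polytope `P^∨ = {x ∈ ℝ^d : ⟨x, y⟩ ≤ 1 for all y ∈ P}`. -/
def dual {d : ℕ} (P : Set (Fin d → ℝ)) : Set (Fin d → ℝ) :=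
  {x | ∀ y ∈ P, x ⬝ᵥ y ≤ 1}

/-- A reflexive polytope `P ⊂ ℝ^d` of dimension `d`. -/
structure IsReflexive {d : ℕ} (P : Set (Fin d → ℝ)) : Prop where
  isLatticePolytope : IsLatticePolytope P
  dimension_eq : dimension P = d
  zero_mem_interior : (0 : Fin d → ℝ) ∈ interior P
  isLatticePolytope_dual : IsLatticePolytope (dual P)

/-- The lattice points `P ∩ ℤ^d` of `P`, as vectors of integers. -/
def latticePoints {d : ℕ} (P : Set (Fin d → ℝ)) : Set (Fin d → ℤ) :=
  {a | (fun i => (a i : ℝ)) ∈ P}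

/-- The Laurent polynomial ring `K[t₁, …, t_d, t₁⁻¹, …, t_d⁻¹, s]`: its monomials
`t₁^{a₁} ⋯ t_d^{a_d} s^n` are indexed by the pairs `(a, n)` in `ℤ^d × ℕ`. -/
abbrev LaurentRing (K : Type*) [Field K] (d : ℕ) : Type _ :=
  AddMonoidAlgebra K ((Fin d → ℤ) × ℕ)

/-- The Laurent monomial `t₁^{a₁} ⋯ t_d^{a_d} s`. -/
noncomputable def latticeMonomial (K : Type*) [Field K] {d : ℕ} (a : Fin d → ℤ) :
    LaurentRing K d :=
  AddMonoidAlgebra.single (a, 1) 1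

/-- The toric ring `K[P]`: the `K`-subalgebra generated by the monomials
`t₁^{a₁} ⋯ t_d^{a_d} s` with `a ∈ P ∩ ℤ^d`. -/
noncomputable def toricRing (K : Type*) [Field K] {d : ℕ} (P : Set (Fin d → ℝ)) :
    Subalgebra K (LaurentRing K d) :=
  Algebra.adjoin K (latticeMonomial K '' latticePoints P)

/-- The graded maximal ideal of `K[P]` (graded by the exponent of `s`): the ideal generated by
the monomial generators of `K[P]`. -/
noncomputable def gradedMaximalIdeal (K : Type*) [Field K] {d : ℕ} (P : Set (Fin d → ℝ)) :
    Ideal (toricRing K P) :=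
  Ideal.span {f | (f : LaurentRing K d) ∈ latticeMonomial K '' latticePoints P}

/-- The grade of an ideal `I` on the ring `R`: the supremum of the lengths of the
`R`-regular sequences contained in `I`. -/
noncomputable def idealGrade {R : Type*} [CommRing R] (I : Ideal R) : ℕ∞ :=
  ⨆ (rs : List R) (_ : RingTheory.Sequence.IsRegular R rs ∧ ∀ r ∈ rs, r ∈ I),
    (rs.length : ℕ∞)

/-- The depth of the standard graded `K`-algebra `K[P]`: the maximal length of a regular
sequence contained in its graded maximal ideal. -/
noncomputable def depth (K : Type*) [Field K] {d : ℕ} (P : Set (Fin d → ℝ)) : ℕ∞ :=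
  idealGrade (gradedMaximalIdeal K P)

end ReflexivePolytope

namespace ReflexivePolytope

open RingTheory.Sequence

/-! `K[P]` is a semigroup ring, so its depth can be bounded by a combinatorial obstruction that does
not mention `K`. Suppose a monomial `x^w` lies outside `K[P]`, but its product with every generator
lies inside. If `f, g` began a regular sequence in the graded maximal ideal, then `g * (f x^w) = f *
(g x^w)` would lie in `f K[P]`, so `f x^w` would too, and cancelling `f` would put `x^w` in `K[P]`.
Hence the depth is at most 1 (`length_le_one_of_isRegular`); it is at least 1 because `K[P]` is a
domain (`isRegular_latticeMonomial`).

It remains to find reflexive polytopes with such a `w`. In dimension 4 an explicit pyramid has one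
in degree 2 (`isSocleExponent_pyramid`). The prism `[-1, 1] × P` preserves both reflexivity and the
existence of `w` (`IsLatticePresentation.prism`, `IsSocleExponent.prism`), which gives every `d ≥
4`. -/

/-- The exponent semigroup of the toric ring: the submonoid of `ℤ^d × ℕ` generated by the pairs
`(a, 1)` with `a` a lattice point of `P`. -/
def exponents {d : ℕ} (P : Set (Fin d → ℝ)) : AddSubmonoid ((Fin d → ℤ) × ℕ) :=
  AddSubmonoid.closure ((fun a => (a, 1)) '' latticePoints P)

/-- A socle exponent: a point outside the exponent semigroup that every generator moves into it. -/
def IsSocleExponent {d : ℕ} (P : Set (Fin d → ℝ)) (w : (Fin d → ℤ) × ℕ) : Prop :=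
  w ∉ exponents P ∧ ∀ a ∈ latticePoints P, w + (a, 1) ∈ exponents P

theorem mk_one_mem_exponents {d : ℕ} {P : Set (Fin d → ℝ)} {a : Fin d → ℤ}
    (ha : a ∈ latticePoints P) : (a, 1) ∈ exponents P :=
  AddSubmonoid.subset_closure ⟨a, ha, rfl⟩

/-! ### Depth of the toric ring from a socle exponent -/

section ToricRing

variable {K : Type*} [Field K] {d : ℕ} {P : Set (Fin d → ℝ)}

theorem single_mem_toricRing {w : (Fin d → ℤ) × ℕ} (hw : w ∈ exponents P) :
    (AddMonoidAlgebra.single w 1 : LaurentRing K d) ∈ toricRing K P := by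
  induction hw using AddSubmonoid.closure_induction with
  | mem x hx =>
    obtain ⟨a, ha, rfl⟩ := hx
    exact Algebra.subset_adjoin ⟨a, ha, rfl⟩
  | zero => exact one_mem _
  | add x y _ _ hx hy =>
    have := mul_mem hx hy
    rwa [AddMonoidAlgebra.single_mul_single, one_mul] at this

theorem support_subset_exponents {f : LaurentRing K d} (hf : f ∈ toricRing K P) :
    ∀ w, f.coeff w ≠ 0 → w ∈ exponents P := by
  classical
  induction hf using Algebra.adjoin_induction with
  | mem x hx =>
    obtain ⟨a, ha, rfl⟩ := hx
    intro w hw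
    by_contra h
    refine hw (Finsupp.single_eq_of_ne ?_)
    rintro rfl
    exact h (mk_one_mem_exponents ha)
  | algebraMap r =>
    intro w hw
    by_contra h
    refine hw (Finsupp.single_eq_of_ne ?_)
    rintro rfl
    exact h (zero_mem _)
  | add x y _ _ hx hy =>
    intro w hw
    by_contra h
    refine hw ?_
    have h1 := not_imp_comm.1 (hx w) h
    have h2 := not_imp_comm.1 (hy w) h
    change x.coeff w + y.coeff w = 0
    rw [h1, h2, add_zero]
  | mul x y _ _ hx hy =>
    intro w hw
    have hw' := AddMonoidAlgebra.support_coeff_mul_subset x y (Finsupp.mem_support_iff.2 hw)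
    obtain ⟨u, hu, v, hv, rfl⟩ := Finset.mem_add.1 hw'
    exact add_mem (hx u (Finsupp.mem_support_iff.1 hu)) (hy v (Finsupp.mem_support_iff.1 hv))

theorem single_mem_toricRing_iff {w : (Fin d → ℤ) × ℕ} :
    (AddMonoidAlgebra.single w 1 : LaurentRing K d) ∈ toricRing K P ↔ w ∈ exponents P := by
  refine ⟨fun h => support_subset_exponents h w ?_, single_mem_toricRing⟩
  rw [show (AddMonoidAlgebra.single w 1 : LaurentRing K d).coeff w = 1 from Finsupp.single_eq_same]
  exact one_ne_zero

theorem mul_single_mem_toricRing {w : (Fin d → ℤ) × ℕ} (hw : IsSocleExponent P w)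
    {g : toricRing K P} (hg : g ∈ gradedMaximalIdeal K P) :
    (g : LaurentRing K d) * AddMonoidAlgebra.single w 1 ∈ toricRing K P := by
  induction hg using Submodule.span_induction with
  | mem x hx =>
    obtain ⟨a, ha, hax⟩ := hx
    rw [← hax, latticeMonomial, AddMonoidAlgebra.single_mul_single, one_mul, add_comm]
    exact single_mem_toricRing (hw.2 a ha)
  | zero => simp
  | add x y _ _ hx hy =>
    rw [Subalgebra.coe_add, add_mul]
    exact add_mem hx hy
  | smul r x _ hx =>
    rw [smul_eq_mul, Subalgebra.coe_mul, mul_assoc]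
    exact mul_mem r.2 hx

theorem length_le_one_of_isRegular {w : (Fin d → ℤ) × ℕ} (hw : IsSocleExponent P w)
    {rs : List (toricRing K P)} (hrs : IsRegular (toricRing K P) rs)
    (hmem : ∀ r ∈ rs, r ∈ gradedMaximalIdeal K P) : rs.length ≤ 1 := by
  match rs, hrs, hmem with
  | [], _, _ => simp
  | [_], _, _ => simp
  | f :: g :: l, hrs, hmem =>
    exfalso
    have hf : f ∈ gradedMaximalIdeal K P := hmem f (by simp)
    have hg : g ∈ gradedMaximalIdeal K P := hmem g (by simp)
    have hreg := hrs.toIsWeaklyRegular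
    rw [isWeaklyRegular_cons_iff, isWeaklyRegular_cons_iff] at hreg
    obtain ⟨hf0, hgreg, -⟩ := hreg
    have hf1 : (f : LaurentRing K d) ≠ 0 := by
      intro h
      have h1 : f • (1 : toricRing K P) = f • (0 : toricRing K P) := by
        rw [show f = 0 from Subtype.ext h]
        simp
      exact one_ne_zero (hf0 h1)
    -- Regularity of `g` modulo `f` is applied to `f x^w`, an element of `K[P]` although `x^w` is
    -- not.
    have hgreg' := (isSMulRegular_quotient_iff_mem_of_smul_mem _ _).1 hgreg
      ⟨_, mul_single_mem_toricRing hw hf⟩ ?_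
    · obtain ⟨r, -, hr⟩ := (Submodule.mem_smul_pointwise_iff_exists _ _ _).1 hgreg'
      have h := congrArg Subtype.val hr
      change (f : LaurentRing K d) * (r : LaurentRing K d) = f * _ at h
      have h' := mul_left_cancel₀ hf1 h
      exact hw.1 ((single_mem_toricRing_iff (K := K)).1 (h' ▸ r.2))
    · refine (Submodule.mem_smul_pointwise_iff_exists _ _ _).2
        ⟨⟨_, mul_single_mem_toricRing hw hg⟩, trivial, Subtype.ext ?_⟩
      change (f : LaurentRing K d) * (g * _) = g * (f * _)
      ring

/-- The `K`-algebra homomorphism killing `s`, and sending every `t_i` to `1`. -/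
noncomputable def constantCoefficient (K : Type*) [Field K] (d : ℕ) : LaurentRing K d →ₐ[K] K :=
  AddMonoidAlgebra.lift K K ((Fin d → ℤ) × ℕ)
    { toFun := fun w => 0 ^ (Multiplicative.toAdd w).2
      map_one' := by simp
      map_mul' := fun x y => by simp [pow_add] }

theorem constantCoefficient_latticeMonomial (a : Fin d → ℤ) :
    constantCoefficient K d (latticeMonomial K a) = 0 := by
  simp [constantCoefficient, latticeMonomial]

theorem isRegular_latticeMonomial {a : Fin d → ℤ} (ha : a ∈ latticePoints P) :
    IsRegular (toricRing K P)
      [(⟨latticeMonomial K a, Algebra.subset_adjoin ⟨a, ha, rfl⟩⟩ : toricRing K P)] := by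
  refine ⟨(isWeaklyRegular_singleton_iff _ _).2 ?_, ?_⟩
  · intro x y hxy
    have h := congrArg Subtype.val hxy
    change latticeMonomial K a * (x : LaurentRing K d) = latticeMonomial K a * y at h
    refine Subtype.ext (mul_left_cancel₀ ?_ h)
    exact fun h0 => one_ne_zero (AddMonoidAlgebra.single_eq_zero.1 h0)
  -- The quotient is nonzero: a homomorphism to `K` kills the monomial, so 1 is not a multiple of
  -- it.
  · intro htop
    have h1 : (1 : toricRing K P) ∈ (⊤ : Submodule (toricRing K P) (toricRing K P)) := trivial
    rw [htop, smul_eq_mul, Ideal.mul_top, Ideal.ofList_singleton,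
      Ideal.mem_span_singleton] at h1
    obtain ⟨r, hr⟩ := h1
    have h := congrArg (fun x : toricRing K P => constantCoefficient K d x) hr
    simp [constantCoefficient_latticeMonomial] at h

theorem depth_eq_one_of_isSocleExponent {a : Fin d → ℤ} (ha : a ∈ latticePoints P)
    {w : (Fin d → ℤ) × ℕ} (hw : IsSocleExponent P w) : depth K P = 1 := by
  refine le_antisymm (iSup₂_le fun rs hrs => ?_) ?_
  · exact_mod_cast length_le_one_of_isRegular hw hrs.1 hrs.2
  · refine le_iSup₂_of_le _ ⟨isRegular_latticeMonomial (K := K) ha, fun r hr => ?_⟩ (by simp)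
    rw [List.mem_singleton.1 hr]
    exact Ideal.subset_span ⟨a, ha, rfl⟩

end ToricRing

open Set

/-! ### Reflexivity from lattice vertices and lattice facet normals -/

/-- Finite sets of lattice points, `S` spanning `P` and `T` cutting out `P` by the inequalities
`⟨f, x⟩ ≤ 1`; the redundant functional `0` is required to belong to `T`. -/
structure IsLatticePresentation {d : ℕ} (P S T : Set (Fin d → ℝ)) : Prop where
  finite_points : S.Finite
  finite_functionals : T.Finite
  isLatticePoint_points : ∀ x ∈ S, IsLatticePoint x
  isLatticePoint_functionals : ∀ f ∈ T, IsLatticePoint f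
  zero_mem : 0 ∈ T
  eq_convexHull : P = convexHull ℝ S
  eq_setOf : P = {x | ∀ f ∈ T, f ⬝ᵥ x ≤ 1}

theorem isLatticePolytope_convexHull {d : ℕ} {S : Set (Fin d → ℝ)} (hS : S.Finite)
    (h : ∀ x ∈ S, IsLatticePoint x) : IsLatticePolytope (convexHull ℝ S) :=
  ⟨⟨hS.toFinset, by rw [hS.coe_toFinset]⟩,
    fun v hv => h v (extremePoints_convexHull_subset hv)⟩

theorem convex_setOf_dotProduct_le {d : ℕ} (y : Fin d → ℝ) (c : ℝ) :
    Convex ℝ {x : Fin d → ℝ | x ⬝ᵥ y ≤ c} :=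
  convex_halfSpace_le ⟨fun a b => add_dotProduct a b y, fun r a => smul_dotProduct r a y⟩ c

/-- This is the bipolar theorem for finite `T`. A functional separating `x` from the hull of `T` has
a positive bound `u` because `0 ∈ T`; dividing by `u` gives a point of the polyhedron that violates
`x ∈ dual`. -/
theorem dual_setOf_eq_convexHull {d : ℕ} {T : Set (Fin d → ℝ)} (hT : T.Finite) (h0 : 0 ∈ T) :
    dual {x | ∀ f ∈ T, f ⬝ᵥ x ≤ 1} = convexHull ℝ T := by
  classical
  refine Subset.antisymm (fun x hx => ?_) (fun x hx y hy => ?_)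
  · by_contra hxT
    obtain ⟨φ, u, hφ, hu⟩ := geometric_hahn_banach_closed_point (convex_convexHull ℝ T)
      (hT.isClosed_convexHull ℝ) hxT
    obtain ⟨y, hy⟩ := (dotProductEquiv ℝ (Fin d)).surjective φ.toLinearMap
    have hφy : ∀ b, φ b = b ⬝ᵥ y := fun b => by
      rw [dotProduct_comm, ← dotProductEquiv_apply_apply, hy]
      rfl
    have hu0 : 0 < u := by
      have := hφ 0 (subset_convexHull ℝ T h0)
      rwa [map_zero] at this
    have h1 := hx (u⁻¹ • y) fun f hf => by
      have := hφ f (subset_convexHull ℝ T hf)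
      rw [hφy] at this
      rw [dotProduct_smul, smul_eq_mul, inv_mul_le_iff₀ hu0]
      linarith
    rw [dotProduct_smul, smul_eq_mul, inv_mul_le_iff₀ hu0, ← hφy] at h1
    linarith
  · exact convexHull_min (fun f hf => hy f hf) (convex_setOf_dotProduct_le y 1) hx

namespace IsLatticePresentation

variable {d : ℕ} {P S T : Set (Fin d → ℝ)}

theorem zero_mem_interior (h : IsLatticePresentation P S T) : (0 : Fin d → ℝ) ∈ interior P := by
  refine interior_maximal (t := ⋂ f ∈ T, {x | f ⬝ᵥ x < 1}) ?_ ?_ ?_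
  · rw [h.eq_setOf]
    exact fun x hx f hf => (mem_iInter₂.1 hx f hf).le
  · refine h.finite_functionals.isOpen_biInter fun f _ => isOpen_lt ?_ continuous_const
    exact continuous_const.dotProduct continuous_id
  · simp

theorem isReflexive (h : IsLatticePresentation P S T) : IsReflexive P where
  isLatticePolytope := by
    rw [h.eq_convexHull]
    exact isLatticePolytope_convexHull h.finite_points h.isLatticePoint_points
  dimension_eq := by
    have hspan : affineSpan ℝ P = ⊤ :=
      affineSpan_eq_top_of_nonempty_interior
        ⟨0, interior_mono (subset_convexHull ℝ P) h.zero_mem_interior⟩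
    rw [dimension, ← direction_affineSpan, hspan, AffineSubspace.direction_top, finrank_top]
    simp
  zero_mem_interior := h.zero_mem_interior
  isLatticePolytope_dual := by
    rw [h.eq_setOf, dual_setOf_eq_convexHull h.finite_functionals h.zero_mem]
    exact isLatticePolytope_convexHull h.finite_functionals h.isLatticePoint_functionals

theorem zero_mem_latticePoints (h : IsLatticePresentation P S T) : 0 ∈ latticePoints P := by
  have := interior_subset h.zero_mem_interior
  simpa [latticePoints, Pi.zero_def] using this

end IsLatticePresentation

/-! ### Prisms -/

/-- The prism `[-1, 1] × P`. -/
def prism {d : ℕ} (P : Set (Fin d → ℝ)) : Set (Fin (d + 1) → ℝ) :=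
  {x | x 0 ∈ Icc (-1) 1 ∧ Fin.tail x ∈ P}

theorem prism_eq_image {d : ℕ} (P : Set (Fin d → ℝ)) :
    prism P = Fin.consLinearEquiv ℝ (fun _ : Fin (d + 1) => ℝ) '' (Icc (-1) 1 ×ˢ P) := by
  ext x
  constructor
  · exact fun hx => ⟨(x 0, Fin.tail x), hx, Fin.cons_self_tail x⟩
  · rintro ⟨⟨t, y⟩, h, rfl⟩
    exact h

theorem isLatticePoint_cons {d : ℕ} {x : Fin d → ℝ} (hx : IsLatticePoint x) (t : ℤ) :
    IsLatticePoint (Fin.cons (t : ℝ) x : Fin (d + 1) → ℝ) := by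
  obtain ⟨a, rfl⟩ := hx
  refine ⟨Fin.cons t a, ?_⟩
  ext i
  refine Fin.cases ?_ (fun j => ?_) i <;> simp

theorem cons_dotProduct_eq {d : ℕ} (t : ℝ) (f : Fin d → ℝ) (x : Fin (d + 1) → ℝ) :
    (Fin.cons t f : Fin (d + 1) → ℝ) ⬝ᵥ x = t * x 0 + f ⬝ᵥ Fin.tail x := by
  simp [dotProduct, Fin.sum_univ_succ, Fin.tail]

theorem IsLatticePresentation.prism {d : ℕ} {P S T : Set (Fin d → ℝ)}
    (h : IsLatticePresentation P S T) :
    IsLatticePresentation (prism P)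
      (Fin.consLinearEquiv ℝ (fun _ : Fin (d + 1) => ℝ) '' ({-1, 1} ×ˢ S))
      ((fun f => Fin.cons 0 f) '' T ∪ {Fin.cons 1 0, Fin.cons (-1) 0}) where
  finite_points := ((toFinite _).prod h.finite_points).image _
  finite_functionals := (h.finite_functionals.image _).union (toFinite _)
  isLatticePoint_points := by
    rintro _ ⟨⟨t, x⟩, ⟨ht, hx⟩, rfl⟩
    rcases ht with rfl | rfl
    · exact_mod_cast isLatticePoint_cons (h.isLatticePoint_points x hx) (-1)
    · exact_mod_cast isLatticePoint_cons (h.isLatticePoint_points x hx) 1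
  isLatticePoint_functionals := by
    rintro _ (⟨f, hf, rfl⟩ | rfl | rfl)
    · simpa using isLatticePoint_cons (h.isLatticePoint_functionals f hf) 0
    · simpa using isLatticePoint_cons (h.isLatticePoint_functionals 0 h.zero_mem) 1
    · simpa using isLatticePoint_cons (h.isLatticePoint_functionals 0 h.zero_mem) (-1)
  zero_mem := Or.inl ⟨0, h.zero_mem, by ext i; refine Fin.cases ?_ (fun j => ?_) i <;> simp⟩
  eq_convexHull := by
    have := (Fin.consLinearEquiv ℝ (fun _ : Fin (d + 1) => ℝ)).toLinearMap.image_convexHull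
      ({-1, 1} ×ˢ S)
    rw [convexHull_prod, convexHull_pair, segment_eq_Icc (by norm_num), ← h.eq_convexHull] at this
    exact (prism_eq_image P).trans this
  eq_setOf := by
    ext x
    have hP : Fin.tail x ∈ P ↔ ∀ f ∈ T, f ⬝ᵥ Fin.tail x ≤ 1 := by
      conv_lhs => rw [h.eq_setOf]
      rfl
    rw [ReflexivePolytope.prism, mem_ofPred_eq, hP, mem_ofPred_eq]
    constructor
    · rintro ⟨h1, h2⟩ _ (⟨f, hf, rfl⟩ | rfl | rfl)
      · simpa [cons_dotProduct_eq] using h2 f hf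
      · simpa [cons_dotProduct_eq] using h1.2
      · simpa [cons_dotProduct_eq] using neg_le.1 h1.1
    · refine fun hx => ⟨⟨?_, ?_⟩, fun f hf => ?_⟩
      · have := hx _ (Or.inr (Or.inr rfl))
        rw [cons_dotProduct_eq, zero_dotProduct] at this
        linarith
      · have := hx _ (Or.inr (Or.inl rfl))
        rw [cons_dotProduct_eq, zero_dotProduct] at this
        linarith
      · simpa [cons_dotProduct_eq] using hx _ (Or.inl ⟨f, hf, rfl⟩)

theorem cons_mem_latticePoints_prism {d : ℕ} {P : Set (Fin d → ℝ)} {t : ℤ} {a : Fin d → ℤ} :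
    (Fin.cons t a : Fin (d + 1) → ℤ) ∈ latticePoints (prism P) ↔
      |t| ≤ 1 ∧ a ∈ latticePoints P := by
  have htail : Fin.tail (fun i => ((Fin.cons t a : Fin (d + 1) → ℤ) i : ℝ)) =
      fun i => (a i : ℝ) := by
    ext i
    simp [Fin.tail]
  rw [latticePoints, mem_ofPred_eq, prism, mem_ofPred_eq, htail, mem_Icc, abs_le]
  refine and_congr_left fun _ => ?_
  change (-1 : ℝ) ≤ (t : ℝ) ∧ (t : ℝ) ≤ 1 ↔ _
  norm_cast

theorem tail_mem_exponents {d : ℕ} {P : Set (Fin d → ℝ)} {w : (Fin (d + 1) → ℤ) × ℕ}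
    (hw : w ∈ exponents (prism P)) : ((Fin.tail w.1 : Fin d → ℤ), w.2) ∈ exponents P := by
  induction hw using AddSubmonoid.closure_induction with
  | mem x hx =>
    obtain ⟨a, ha, rfl⟩ := hx
    rw [← Fin.cons_self_tail a] at ha
    exact mk_one_mem_exponents (cons_mem_latticePoints_prism.1 ha).2
  | zero => exact zero_mem _
  | add x y _ _ hx hy => exact add_mem hx hy

theorem cons_add_cons {d : ℕ} (s t : ℤ) (a b : Fin d → ℤ) :
    (Fin.cons s a + Fin.cons t b : Fin (d + 1) → ℤ) = Fin.cons (s + t) (a + b) := by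
  ext i
  refine Fin.cases ?_ (fun j => ?_) i <;> simp

/-- In a sum of `n` lattice points of `P`, each summand may be given a new coordinate in `{-1, 0,
1}`, so the total takes every integer value in `[-n, n]`. -/
theorem cons_mem_exponents {d : ℕ} {P : Set (Fin d → ℝ)} {w : (Fin d → ℤ) × ℕ}
    (hw : w ∈ exponents P) : ∀ t : ℤ, |t| ≤ w.2 →
      ((Fin.cons t w.1 : Fin (d + 1) → ℤ), w.2) ∈ exponents (prism P) := by
  induction hw using AddSubmonoid.closure_induction with
  | mem x hx =>
    obtain ⟨a, ha, rfl⟩ := hx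
    exact fun t ht => mk_one_mem_exponents (cons_mem_latticePoints_prism.2 ⟨by simpa using ht, ha⟩)
  | zero =>
    intro t ht
    obtain rfl : t = 0 := by simpa using ht
    convert zero_mem (exponents (prism P)) using 1
    refine Prod.ext ?_ rfl
    ext i
    refine Fin.cases ?_ (fun j => ?_) i <;> simp
  | add x y _ _ hx hy =>
    intro t ht
    obtain ⟨s, hs, hst⟩ : ∃ s : ℤ, |s| ≤ x.2 ∧ |t - s| ≤ y.2 := by
      rw [Prod.snd_add, Nat.cast_add, abs_le] at ht
      -- Clamp `t` to `[-x.2, x.2]`; the excess is at most `y.2`.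
      refine ⟨max (-x.2) (min t x.2), ?_, ?_⟩ <;> rw [abs_le] <;> omega
    have := add_mem (hx s hs) (hy (t - s) hst)
    rwa [Prod.mk_add_mk, cons_add_cons, add_sub_cancel] at this

/-- Projection shows that the lift stays outside. Adding a generator gives degree at least 1, enough
room for its new coordinate in `{-1, 0, 1}`. -/
theorem IsSocleExponent.prism {d : ℕ} {P : Set (Fin d → ℝ)} {w : (Fin d → ℤ) × ℕ}
    (hw : IsSocleExponent P w) :
    IsSocleExponent (prism P) ((Fin.cons 0 w.1 : Fin (d + 1) → ℤ), w.2) := by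
  refine ⟨fun h => hw.1 (tail_mem_exponents h), fun a ha => ?_⟩
  rw [← Fin.cons_self_tail a] at ha ⊢
  obtain ⟨ht, ha⟩ := cons_mem_latticePoints_prism.1 ha
  rw [Prod.mk_add_mk, cons_add_cons, zero_add]
  refine cons_mem_exponents (hw.2 _ ha) _ (ht.trans ?_)
  simp

/-! ### The four-dimensional pyramid -/

/-- The vertices of a four-dimensional pyramid. -/
def pyramidVertices : Set (Fin 4 → ℝ) :=
  {![0, 0, -1, 1],
    ![0, 0, 0, 1],
    ![1, 1, -1, 1],
    ![1, 1, 0, 1],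
    ![1, 0, 1, 1],
    ![1, 0, 2, 1],
    ![0, 1, 1, 1],
    ![0, 1, 2, 1],
    ![-1, -1, -1, -2]}

/-- The functionals cutting out the pyramid, together with `0`. -/
def pyramidFunctionals : Set (Fin 4 → ℝ) :=
  {0, ![-3, 0, 0, 1],
    ![-2, -2, 1, 1],
    ![-2, 2, -1, 0],
    ![0, -3, 0, 1],
    ![0, 0, 0, 1],
    ![0, 3, 0, -2],
    ![2, -2, -1, 0],
    ![2, 2, 1, -3],
    ![3, 0, 0, -2]}

/-- A four-dimensional reflexive pyramid over a three-dimensional polytope that is not normal. -/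
def pyramid : Set (Fin 4 → ℝ) :=
  convexHull ℝ pyramidVertices

/-- The facet inequalities of the pyramid. -/
structure PyramidInequalities {R : Type*} [Ring R] [LE R] (x : Fin 4 → R) : Prop where
  left : -3 * x 0 + x 3 ≤ 1
  front : -3 * x 1 + x 3 ≤ 1
  right : 3 * x 0 - 2 * x 3 ≤ 1
  back : 3 * x 1 - 2 * x 3 ≤ 1
  lower₀ : 2 * x 0 - 2 * x 1 - x 2 ≤ 1
  lower₁ : -2 * x 0 + 2 * x 1 - x 2 ≤ 1
  upper₀ : -2 * x 0 - 2 * x 1 + x 2 + x 3 ≤ 1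
  upper₁ : 2 * x 0 + 2 * x 1 + x 2 - 3 * x 3 ≤ 1
  base : x 3 ≤ 1

theorem forall_pyramidFunctionals_iff {x : Fin 4 → ℝ} :
    (∀ f ∈ pyramidFunctionals, f ⬝ᵥ x ≤ 1) ↔ PyramidInequalities x := by
  simp only [pyramidFunctionals, mem_insert_iff, mem_singleton_iff, forall_eq_or_imp, forall_eq,
    dotProduct, Fin.sum_univ_four, Matrix.cons_val, Pi.zero_apply]
  constructor
  · rintro ⟨-, h1, h2, h3, h4, h5, h6, h7, h8, h9⟩
    constructor <;> linarith
  · rintro ⟨h1, h2, h3, h4, h5, h6, h7, h8, h9⟩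
    refine ⟨?_, ?_, ?_, ?_, ?_, ?_, ?_, ?_, ?_, ?_⟩ <;> linarith

theorem pyramidVertices_inequalities {x : Fin 4 → ℝ} (hx : x ∈ pyramidVertices) :
    PyramidInequalities x := by
  simp only [pyramidVertices, mem_insert_iff, mem_singleton_iff] at hx
  rcases hx with rfl | rfl | rfl | rfl | rfl | rfl | rfl | rfl | rfl <;>
    constructor <;> simp only [Matrix.cons_val] <;> norm_num

theorem _root_.Convex.sum_four_mem {E : Type*} [AddCommGroup E] [Module ℝ E] {C : Set E}
    (hC : Convex ℝ C) {p q r s : E} (hp : p ∈ C) (hq : q ∈ C) (hr : r ∈ C) (hs : s ∈ C)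
    {a b c e : ℝ} (ha : 0 ≤ a) (hb : 0 ≤ b) (hc : 0 ≤ c) (he : 0 ≤ e) (h : a + b + c + e = 1) :
    a • p + b • q + c • r + e • s ∈ C := by
  have := hC.sum_mem (t := Finset.univ) (w := ![a, b, c, e]) (z := ![p, q, r, s])
    (fun i _ => by fin_cases i <;> simpa) (by simpa [Fin.sum_univ_four] using h)
    (fun i _ => by fin_cases i <;> simpa)
  simpa [Fin.sum_univ_four] using this

/-- A point of `ℝ^4` lying, in the third coordinate direction, between two points of a convex set
belongs to that set. -/
theorem mem_of_between {C : Set (Fin 4 → ℝ)} (hC : Convex ℝ C) {x : Fin 4 → ℝ} {l u : ℝ}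
    (hl : ![x 0, x 1, l, x 3] ∈ C) (hu : ![x 0, x 1, u, x 3] ∈ C) (h1 : l ≤ x 2) (h2 : x 2 ≤ u) :
    x ∈ C := by
  obtain ⟨a, b, ha, hb, hab, h⟩ := (segment_eq_Icc (h1.trans h2)).symm ▸ mem_Icc.2 ⟨h1, h2⟩
  convert hC hl hu ha hb hab using 1
  ext i
  fin_cases i
  · change x 0 = a * x 0 + b * x 0
    rw [← add_mul, hab, one_mul]
  · change x 1 = a * x 1 + b * x 1
    rw [← add_mul, hab, one_mul]
  · exact h.symm
  · change x 3 = a * x 3 + b * x 3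
    rw [← add_mul, hab, one_mul]

/-- Along the third coordinate, the pyramid lies between two piecewise linear graphs. Each graph has
two pieces, each a simplex spanned by the apex and three base vertices, so the point below and the
point above `x` have explicit barycentric coordinates. The apex weight is `(1 - x 3) / 3`, since `x
3` is 1 on the base and -2 at the apex. -/
theorem mem_pyramid_of_inequalities {x : Fin 4 → ℝ} (hx : PyramidInequalities x) :
    x ∈ pyramid := by
  obtain ⟨h1, h2, h3, h4, h5, h6, h7, h8, h9⟩ := hx
  have hC : Convex ℝ pyramid := convex_convexHull ℝ _
  have hv : ∀ v ∈ pyramidVertices, v ∈ pyramid := subset_convexHull ℝ _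
  have hl : ∃ l ≤ x 2, ![x 0, x 1, l, x 3] ∈ pyramid := by
    rcases le_total (x 1) (x 0) with h | h
    · refine ⟨2 * (x 0 - x 1) - 1, by linarith, ?_⟩
      convert hC.sum_four_mem (p := ![0, 0, -1, 1]) (q := ![1, 0, 1, 1]) (r := ![1, 1, -1, 1])
        (s := ![-1, -1, -1, -2]) (hv _ (by simp [pyramidVertices]))
        (hv _ (by simp [pyramidVertices])) (hv _ (by simp [pyramidVertices]))
        (hv _ (by simp [pyramidVertices]))
        (a := (1 + 2 * x 3 - 3 * x 0) / 3) (b := x 0 - x 1) (c := (1 - x 3 + 3 * x 1) / 3)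
        (e := (1 - x 3) / 3) (by linarith) (by linarith) (by linarith) (by linarith)
        (by ring) using 1
      ext i
      fin_cases i <;> simp [Matrix.cons_val] <;> ring
    · refine ⟨2 * (x 1 - x 0) - 1, by linarith, ?_⟩
      convert hC.sum_four_mem (p := ![0, 0, -1, 1]) (q := ![0, 1, 1, 1]) (r := ![1, 1, -1, 1])
        (s := ![-1, -1, -1, -2]) (hv _ (by simp [pyramidVertices]))
        (hv _ (by simp [pyramidVertices])) (hv _ (by simp [pyramidVertices]))
        (hv _ (by simp [pyramidVertices]))
        (a := (1 + 2 * x 3 - 3 * x 1) / 3) (b := x 1 - x 0) (c := (1 - x 3 + 3 * x 0) / 3)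
        (e := (1 - x 3) / 3) (by linarith) (by linarith) (by linarith) (by linarith)
        (by ring) using 1
      ext i
      fin_cases i <;> simp [Matrix.cons_val] <;> ring
  have hu : ∃ u, x 2 ≤ u ∧ ![x 0, x 1, u, x 3] ∈ pyramid := by
    rcases le_total (x 0 + x 1) (x 3) with h | h
    · refine ⟨2 * x 0 + 2 * x 1 + 1 - x 3, by linarith, ?_⟩
      convert hC.sum_four_mem (p := ![1, 0, 2, 1]) (q := ![0, 1, 2, 1]) (r := ![0, 0, 0, 1])
        (s := ![-1, -1, -1, -2]) (hv _ (by simp [pyramidVertices]))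
        (hv _ (by simp [pyramidVertices])) (hv _ (by simp [pyramidVertices]))
        (hv _ (by simp [pyramidVertices]))
        (a := x 0 + (1 - x 3) / 3) (b := x 1 + (1 - x 3) / 3) (c := x 3 - x 0 - x 1)
        (e := (1 - x 3) / 3) (by linarith) (by linarith) (by linarith) (by linarith)
        (by ring) using 1
      ext i
      fin_cases i <;> simp [Matrix.cons_val] <;> ring
    · refine ⟨3 * x 3 + 1 - 2 * x 0 - 2 * x 1, by linarith, ?_⟩
      convert hC.sum_four_mem (p := ![1, 1, 0, 1]) (q := ![1, 0, 2, 1]) (r := ![0, 1, 2, 1])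
        (s := ![-1, -1, -1, -2]) (hv _ (by simp [pyramidVertices]))
        (hv _ (by simp [pyramidVertices])) (hv _ (by simp [pyramidVertices]))
        (hv _ (by simp [pyramidVertices]))
        (a := x 0 + x 1 - x 3) (b := (1 + 2 * x 3 - 3 * x 1) / 3) (c := (1 + 2 * x 3 - 3 * x 0) / 3)
        (e := (1 - x 3) / 3) (by linarith) (by linarith) (by linarith) (by linarith)
        (by ring) using 1
      ext i
      fin_cases i <;> simp [Matrix.cons_val] <;> ring
  obtain ⟨l, hl, hl'⟩ := hl
  obtain ⟨u, hu, hu'⟩ := hu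
  exact mem_of_between hC hl' hu' hl hu

theorem mem_pyramid_iff {x : Fin 4 → ℝ} : x ∈ pyramid ↔ PyramidInequalities x := by
  refine ⟨fun hx => forall_pyramidFunctionals_iff.1 fun f hf => ?_, mem_pyramid_of_inequalities⟩
  have hf' : Convex ℝ {y : Fin 4 → ℝ | f ⬝ᵥ y ≤ 1} := by
    simpa only [dotProduct_comm f] using convex_setOf_dotProduct_le f 1
  exact convexHull_min
    (fun v hv => forall_pyramidFunctionals_iff.2 (pyramidVertices_inequalities hv) f hf) hf' hx

theorem isLatticePresentation_pyramid :
    IsLatticePresentation pyramid pyramidVertices pyramidFunctionals where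
  finite_points := by
    unfold pyramidVertices
    exact toFinite _
  finite_functionals := by
    unfold pyramidFunctionals
    exact toFinite _
  isLatticePoint_points := by
    intro x hx
    refine ⟨fun i => ⌊x i⌋, ?_⟩
    simp only [pyramidVertices, mem_insert_iff, mem_singleton_iff] at hx
    rcases hx with rfl | rfl | rfl | rfl | rfl | rfl | rfl | rfl | rfl <;>
      ext i <;> fin_cases i <;> simp [Matrix.cons_val] <;> norm_num
  isLatticePoint_functionals := by
    intro x hx
    refine ⟨fun i => ⌊x i⌋, ?_⟩
    simp only [pyramidFunctionals, mem_insert_iff, mem_singleton_iff] at hx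
    rcases hx with rfl | rfl | rfl | rfl | rfl | rfl | rfl | rfl | rfl | rfl <;>
      ext i <;> fin_cases i <;> simp [Matrix.cons_val] <;> norm_num
  zero_mem := mem_insert _ _
  eq_convexHull := rfl
  eq_setOf := by
    ext x
    exact mem_pyramid_iff.trans forall_pyramidFunctionals_iff.symm

theorem mem_latticePoints_pyramid_iff {a : Fin 4 → ℤ} :
    a ∈ latticePoints pyramid ↔ PyramidInequalities a := by
  rw [latticePoints, mem_ofPred_eq, mem_pyramid_iff]
  constructor <;> rintro ⟨h1, h2, h3, h4, h5, h6, h7, h8, h9⟩ <;> constructor <;>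
    norm_cast at *

/-- The lattice points of the pyramid. -/
def pyramidPoints : Finset (Fin 4 → ℤ) :=
  {![-1, -1, -1, -2], ![0, 0, -1, 0], ![0, 0, -1, 1], ![0, 0, 0, 0],
    ![0, 0, 0, 1], ![0, 0, 1, 0], ![0, 1, 1, 1], ![0, 1, 2, 1],
    ![1, 0, 1, 1], ![1, 0, 2, 1], ![1, 1, -1, 1], ![1, 1, 0, 1]}

theorem latticePoints_pyramid : latticePoints pyramid = pyramidPoints := by
  ext a
  rw [mem_latticePoints_pyramid_iff, Finset.mem_coe]
  constructor
  · rintro ⟨h1, h2, h3, h4, h5, h6, h7, h8, h9⟩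
    obtain ⟨p, q, r, s, rfl⟩ : ∃ p q r s, a = ![p, q, r, s] :=
      ⟨a 0, a 1, a 2, a 3, by ext i; fin_cases i <;> rfl⟩
    simp only [Matrix.cons_val] at h1 h2 h3 h4 h5 h6 h7 h8 h9
    -- Add `h1` and `h3`; the bounds on `p` and `q` then follow from `-2 ≤ s ≤ 1`.
    have hs : -2 ≤ s := by omega
    have hp : -1 ≤ p := by omega
    have hp' : p ≤ 1 := by omega
    have hq : -1 ≤ q := by omega
    have hq' : q ≤ 1 := by omega
    interval_cases s <;> interval_cases p <;> try omega
    all_goals interval_cases q <;> try omega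
    all_goals
      have hr : -1 ≤ r := by omega
      have hr' : r ≤ 2 := by omega
      interval_cases r <;> first | omega | decide
  · intro ha
    simp only [pyramidPoints, Finset.mem_insert, Finset.mem_singleton] at ha
    rcases ha with rfl | rfl | rfl | rfl | rfl | rfl | rfl | rfl | rfl | rfl | rfl | rfl <;>
      constructor <;> decide

theorem mem_exponents_of_snd_le_two {d : ℕ} {P : Set (Fin d → ℝ)} {w : (Fin d → ℤ) × ℕ}
    (hw : w ∈ exponents P) :
    (w.2 = 0 → w.1 = 0) ∧ (w.2 = 1 → w.1 ∈ latticePoints P) ∧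
      (w.2 = 2 → ∃ a ∈ latticePoints P, ∃ b ∈ latticePoints P, w.1 = a + b) := by
  induction hw using AddSubmonoid.closure_induction with
  | mem x hx =>
    obtain ⟨a, ha, rfl⟩ := hx
    simp [ha]
  | zero => simp
  | add x y _ _ hx hy =>
    obtain ⟨x0, x1, x2⟩ := hx
    obtain ⟨y0, y1, y2⟩ := hy
    rw [Prod.fst_add, Prod.snd_add]
    refine ⟨fun h => ?_, fun h => ?_, fun h => ?_⟩
    · rw [x0 (by omega), y0 (by omega), add_zero]
    · obtain h | h : x.2 = 0 ∨ y.2 = 0 := by omega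
      · rw [x0 h, zero_add]
        exact y1 (by omega)
      · rw [y0 h, add_zero]
        exact x1 (by omega)
    · obtain h | h | h : x.2 = 0 ∨ x.2 = 1 ∨ y.2 = 0 := by omega
      · rw [x0 h, zero_add]
        exact y2 (by omega)
      · exact ⟨x.1, x1 h, y.1, y1 (by omega), rfl⟩
      · rw [y0 h, add_zero]
        exact x2 (by omega)

/-- Since `x 3 ≤ 1` on the pyramid, two lattice points summing to `![1, 1, 1, 2]` must both lie in
the base. Their first two coordinates are those of opposite corners of the unit square. One diagonal
gives third coordinate in `{-2, -1, 0}`, the other in `{2, 3, 4}`, so 1 is missed. After adding any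
of the 12 lattice points, an explicit sum of three exists. -/
theorem isSocleExponent_pyramid : IsSocleExponent pyramid (![1, 1, 1, 2], 2) := by
  have key : ∀ u v w a, u ∈ pyramidPoints → v ∈ pyramidPoints → w ∈ pyramidPoints →
      ![1, 1, 1, 2] + a = u + v + w → ((![1, 1, 1, 2], 2) + (a, 1) : (Fin 4 → ℤ) × ℕ) ∈
        exponents pyramid := by
    intro u v w a hu hv hw h
    rw [← Finset.mem_coe, ← latticePoints_pyramid] at hu hv hw
    rw [Prod.mk_add_mk, h]
    exact add_mem (add_mem (mk_one_mem_exponents hu) (mk_one_mem_exponents hv))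
      (mk_one_mem_exponents hw)
  refine ⟨fun h => ?_, fun a ha => ?_⟩
  · obtain ⟨a, ha, b, hb, hab⟩ := (mem_exponents_of_snd_le_two h).2.2 rfl
    rw [latticePoints_pyramid, Finset.mem_coe] at ha hb
    revert a b
    decide
  rw [latticePoints_pyramid, Finset.mem_coe] at ha
  simp only [pyramidPoints, Finset.mem_insert, Finset.mem_singleton] at ha
  rcases ha with rfl | rfl | rfl | rfl | rfl | rfl | rfl | rfl | rfl | rfl | rfl | rfl
  · exact key ![0, 0, -1, 0] ![0, 0, 0, 0] ![0, 0, 1, 0] _ (by decide) (by decide) (by decide) (by decide)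
  · exact key ![0, 0, -1, 1] ![0, 0, 1, 0] ![1, 1, 0, 1] _ (by decide) (by decide) (by decide) (by decide)
  · exact key ![0, 0, 0, 1] ![0, 0, 0, 1] ![1, 1, 0, 1] _ (by decide) (by decide) (by decide) (by decide)
  · exact key ![0, 0, -1, 0] ![0, 1, 1, 1] ![1, 0, 1, 1] _ (by decide) (by decide) (by decide) (by decide)
  · exact key ![0, 0, -1, 1] ![0, 1, 1, 1] ![1, 0, 1, 1] _ (by decide) (by decide) (by decide) (by decide)
  · exact key ![0, 0, -1, 0] ![0, 1, 1, 1] ![1, 0, 2, 1] _ (by decide) (by decide) (by decide) (by decide)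
  · exact key ![0, 0, 0, 1] ![0, 1, 2, 1] ![1, 1, 0, 1] _ (by decide) (by decide) (by decide) (by decide)
  · exact key ![0, 1, 1, 1] ![0, 1, 1, 1] ![1, 0, 1, 1] _ (by decide) (by decide) (by decide) (by decide)
  · exact key ![0, 0, 0, 1] ![1, 0, 2, 1] ![1, 1, 0, 1] _ (by decide) (by decide) (by decide) (by decide)
  · exact key ![0, 1, 1, 1] ![1, 0, 1, 1] ![1, 0, 1, 1] _ (by decide) (by decide) (by decide) (by decide)
  · exact key ![0, 0, 0, 1] ![1, 1, 0, 1] ![1, 1, 0, 1] _ (by decide) (by decide) (by decide) (by decide)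
  · exact key ![0, 1, 1, 1] ![1, 0, 1, 1] ![1, 1, -1, 1] _ (by decide) (by decide) (by decide) (by decide)

theorem exists_isLatticePresentation_isSocleExponent (d : ℕ) (hd : 4 ≤ d) :
    ∃ P S T : Set (Fin d → ℝ), IsLatticePresentation P S T ∧ ∃ w, IsSocleExponent P w := by
  induction d, hd using Nat.le_induction with
  | base => exact ⟨_, _, _, isLatticePresentation_pyramid, _, isSocleExponent_pyramid⟩
  | succ d _ ih =>
    obtain ⟨P, S, T, h, w, hw⟩ := ih
    exact ⟨_, _, _, h.prism, _, hw.prism⟩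

end ReflexivePolytope

theorem mainTheorem5 (d : ℕ) (hd : 4 ≤ d) :
    ∃ P : Set (Fin d → ℝ), ReflexivePolytope.IsReflexive P ∧
      ∀ (K : Type*) [Field K], ReflexivePolytope.depth K P = 1 := by
  obtain ⟨P, S, T, h, w, hw⟩ :=
    ReflexivePolytope.exists_isLatticePresentation_isSocleExponent d hd
  exact ⟨P, h.isReflexive, fun K _ =>
    ReflexivePolytope.depth_eq_one_of_isSocleExponent h.zero_mem_latticePoints hw⟩
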